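/- Let $\Bbbk$ be a field and let $L\subset\mathbb Z^n$ be a lattice, i.e. a subgroup of $\mathbb Z^n$ (of any rank). The lattice ideal of $L$ is $I_L=\langle x^u-x^v : u,v\in\mathbb N^n,\ u-v\in L\rangle\subset \Bbbk[x_1,\dots,x_n]$. By a binomial we mean a polynomial of the form $x^u-x^v$, and $\mu(I_L)$ denotes the least cardinality of a generating set of $I_L$ consisting of binomials. Let $L^+=L\cap\mathbb N^n$, let $\sigma=\sigma_L\subset\{1,\dots,n\}$ be the set of all $i$ such that $u_i\neq0$ for some $u\in L^+$, and let $L_{pure}$ be the subgroup of $L$ generated by $L^+$. Let $L^\sigma=\{(u_i)_{i\notin\sigma} : u\in L\}\subset\mathbb Z^{\{1,\dots,n\}\setminus\sigma}$ be the projection of $L$ to the coordinates outside $\sigma$, with its lattice ideal $I_{L^\sigma}\subset\Bbbk[x_i : i\notin\sigma]$. Then $L^\sigma$ is positively graded, i.e. its only vector with all coordinates nonnegative is $\mathbf 0$; the numbers $\mu(I_L)$ and $\mu(I_{L^\sigma})$ are finite; and $$\mu(I_L)=\mu(I_{L^\sigma})+\operatorname{rank}(L_{pure}).$$ -/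

import Mathlib

namespace BinomialLattice

/-- The set `L⁺ = L ∩ ℕ^ι` of vectors of the lattice `L ⊆ ℤ^ι` with nonnegative coordinates.
A lattice is an arbitrary subgroup of `ℤ^ι`, of any rank. -/
def plus {ι : Type*} (L : AddSubgroup (ι → ℤ)) : Set (ι → ℤ) :=
  {u | u ∈ L ∧ ∀ i, 0 ≤ u i}

/-- `L` is positively graded: `L ∩ ℕ^ι = {0}`. -/
def IsPositivelyGraded {ι : Type*} (L : AddSubgroup (ι → ℤ)) : Prop :=
  plus L = {0}

/-- The support `σ_L` of `L⁺`: the union of the supports of its elements. -/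
def sigma {ι : Type*} (L : AddSubgroup (ι → ℤ)) : Set ι :=
  ⋃ u ∈ plus L, Function.support u

/-- `L_pure`, the subgroup of `L` generated by `L⁺`. -/
def purePart {ι : Type*} (L : AddSubgroup (ι → ℤ)) : AddSubgroup (ι → ℤ) :=
  AddSubgroup.closure (plus L)

/-- The coordinate projection `u ↦ u^s = (u_i)_{i ∉ s}` that forgets the coordinates in `s`. -/
def outside {ι : Type*} (s : Set ι) : (ι → ℤ) →+ ({i : ι // i ∉ s} → ℤ) where
  toFun u := fun i => u i.1
  map_zero' := rfl
  map_add' _ _ := rfl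

/-- `L^σ`: the image of `L` under the projection to the coordinates outside `σ_L`. -/
def projOutside {ι : Type*} (L : AddSubgroup (ι → ℤ)) :
    AddSubgroup ({i : ι // i ∉ sigma L} → ℤ) :=
  L.map (outside (sigma L))

/-- The binomial `x^u - x^v`. -/
noncomputable def binomial (k : Type*) [Field k] {ι : Type*} (u v : ι →₀ ℕ) :
    MvPolynomial ι k :=
  MvPolynomial.monomial u 1 - MvPolynomial.monomial v 1

/-- The lattice ideal `I_L = ⟨x^u - x^v : u - v ∈ L⟩` in the polynomial ring
`k[x_i : i ∈ ι]`; the difference `u - v` is taken in `ℤ^ι`. -/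
noncomputable def latticeIdeal (k : Type*) [Field k] {ι : Type*}
    (L : AddSubgroup (ι → ℤ)) : Ideal (MvPolynomial ι k) :=
  Ideal.span {f | ∃ u v : ι →₀ ℕ, (fun i => (u i : ℤ) - (v i : ℤ)) ∈ L ∧ f = binomial k u v}

/-- `S` is a generating set of the ideal `J` that consists of binomials. -/
def IsBinomialGenerating {k : Type*} [Field k] {ι : Type*} (J : Ideal (MvPolynomial ι k))
    (S : Set (MvPolynomial ι k)) : Prop :=
  (∀ f ∈ S, ∃ u v : ι →₀ ℕ, f = binomial k u v) ∧ Ideal.span S = J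

/-- `μ(J)`: the least cardinality of a generating set of `J` consisting of binomials, with value
`⊤` if there is no finite one. A finite generating set of least cardinality is automatically
minimal with respect to inclusion, so this is also the least cardinality of a minimal
generating set of binomials. -/
noncomputable def mu {k : Type*} [Field k] {ι : Type*} (J : Ideal (MvPolynomial ι k)) : ℕ∞ :=
  ⨅ S : {S : Set (MvPolynomial ι k) // IsBinomialGenerating J S}, S.1.encard

end BinomialLattice

/-! Some `w ∈ L⁺` is positive on all of `σ`, and `L⁺` vanishes off `σ`. Adding multiples of `w`
therefore moves any vector of `L` that is nonnegative off `σ` into `L⁺`. Hence `L^σ` is positively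
graded, and `L_pure` consists of the vectors of `L` vanishing off `σ` (`mem_purePart`). It has at
most `rank L_pure` generators in `L⁺` (`exists_generators_purePart`).

Membership of binomials in binomial ideals is a question about congruences on exponents
(`addCon_of_binomial_mem_span`).

Lower bound: among binomial generators of `I_L`, those supported in `σ` have differences generating
`L_pure`; the others generate `I_{L^σ}` once the variables in `σ` are set to `1`.

Upper bound: lift generators of `I_{L^σ}` and adjoin `x^b - 1` for the generators `b` of `L_pure`.
The latter make the variables in `σ` invertible, so relations can be compared off `σ`
(`rel_of_restrictCon`). -/

namespace BinomialLattice

open MvPolynomial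

/-! ### Binomial ideals and congruences -/

/-- The congruence contains every pair of exponents whose binomial lies in an ideal generated by
binomials of the congruence. -/
theorem addCon_of_binomial_mem_span {k : Type*} [Field k] {ι : Type*} (c : AddCon (ι →₀ ℕ))
    {S : Set (MvPolynomial ι k)} (hS : ∀ f ∈ S, ∃ u v, c u v ∧ f = binomial k u v)
    {u v : ι →₀ ℕ} (h : binomial k u v ∈ Ideal.span S) : c u v := by
  -- `φ` kills `S`, while distinct classes give distinct basis elements of the monoid algebra of the
  -- quotient.
  let φ : MvPolynomial ι k →+* AddMonoidAlgebra k c.Quotient :=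
    AddMonoidAlgebra.mapDomainRingHom k c.mk'
  have hφ (w : ι →₀ ℕ) : φ (monomial w 1) = AddMonoidAlgebra.single (w : c.Quotient) 1 :=
    AddMonoidAlgebra.mapDomain_single
  have hle : Ideal.span S ≤ RingHom.ker φ := by
    refine Ideal.span_le.2 fun f hf => ?_
    obtain ⟨a, b, hab, rfl⟩ := hS f hf
    simp only [SetLike.mem_coe, RingHom.mem_ker, binomial, map_sub, hφ]
    rw [(AddCon.eq c).2 hab, sub_self]
  have := hle h
  simp only [RingHom.mem_ker, binomial, map_sub, hφ, sub_eq_zero] at this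
  exact (AddCon.eq c).1 (AddMonoidAlgebra.single_left_injective one_ne_zero this)

/-- The congruence of those pairs of exponents whose binomial lies in a given ideal. -/
def idealCon {k : Type*} [Field k] {ι : Type*} (J : Ideal (MvPolynomial ι k)) :
    AddCon (ι →₀ ℕ) where
  r u v := binomial k u v ∈ J
  iseqv :=
    { refl := fun u => by simp [binomial]
      symm := fun {u v} h => by
        have := J.neg_mem h
        simpa [binomial] using this
      trans := fun {u v w} h h' => by
        have := J.add_mem h h'
        simpa [binomial] using this }
  add' := fun {u v u' v'} h h' => by
    have := J.add_mem (J.mul_mem_left (monomial u' 1) h) (J.mul_mem_left (monomial v 1) h')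
    have key : binomial k (u + u') (v + v') =
        monomial u' 1 * binomial k u v + monomial v 1 * binomial k u' v' := by
      simp only [binomial, mul_sub, monomial_mul, one_mul]
      rw [add_comm u' u, add_comm u' v]
      ring
    exact key ▸ this

/-- The congruence of a lattice: exponents are identified if they differ by a lattice vector. -/
def latticeCon {ι : Type*} (L : AddSubgroup (ι → ℤ)) : AddCon (ι →₀ ℕ) where
  r u v := (fun i => (u i : ℤ) - (v i : ℤ)) ∈ L
  iseqv :=
    { refl := fun u => by
        convert L.zero_mem using 1
        ext i; simp
      symm := fun {u v} h => by
        convert L.neg_mem h using 1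
        ext i; simp
      trans := fun {u v w} h h' => by
        convert L.add_mem h h' using 1
        ext i; simp }
  add' := fun {u v u' v'} h h' => by
    convert L.add_mem h h' using 1
    ext i; simp; ring

theorem latticeCon_iff {ι : Type*} {L : AddSubgroup (ι → ℤ)} {u v : ι →₀ ℕ} :
    latticeCon L u v ↔ (fun i => (u i : ℤ) - (v i : ℤ)) ∈ L := Iff.rfl

theorem binomial_mem_latticeIdeal {k : Type*} [Field k] {ι : Type*} {L : AddSubgroup (ι → ℤ)}
    {u v : ι →₀ ℕ} :
    binomial k u v ∈ latticeIdeal k L ↔ (fun i => (u i : ℤ) - (v i : ℤ)) ∈ L :=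
  ⟨fun h => latticeCon_iff.1 <| addCon_of_binomial_mem_span (latticeCon L) (fun _ hf => hf) h,
    fun h => Ideal.subset_span ⟨u, v, h, rfl⟩⟩

/-! ### Finiteness of `μ` -/

theorem exists_finite_isBinomialGenerating (k : Type*) [Field k] {ι : Type*} [Finite ι]
    (L : AddSubgroup (ι → ℤ)) :
    ∃ S : Set (MvPolynomial ι k), S.Finite ∧ IsBinomialGenerating (latticeIdeal k L) S := by
  obtain ⟨T, hT, hT'⟩ := (Submodule.fg_span_iff_fg_span_finset_subset _).1
    (IsNoetherian.noetherian (latticeIdeal k L))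
  refine ⟨T, T.finite_toSet, fun f hf => ?_, hT'.symm⟩
  obtain ⟨u, v, -, h⟩ := hT hf
  exact ⟨u, v, h⟩

theorem mu_le {k : Type*} [Field k] {ι : Type*} {J : Ideal (MvPolynomial ι k)}
    {S : Set (MvPolynomial ι k)} (hS : IsBinomialGenerating J S) : mu J ≤ S.encard :=
  iInf_le (fun S : {S : Set (MvPolynomial ι k) // IsBinomialGenerating J S} => S.1.encard) ⟨S, hS⟩

theorem mu_latticeIdeal_ne_top (k : Type*) [Field k] {ι : Type*} [Finite ι]
    (L : AddSubgroup (ι → ℤ)) : mu (latticeIdeal k L) ≠ ⊤ := by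
  obtain ⟨S, hS, hS'⟩ := exists_finite_isBinomialGenerating k L
  exact ne_top_of_le_ne_top hS.encard_lt_top.ne (mu_le hS')

theorem exists_encard_eq_mu (k : Type*) [Field k] {ι : Type*} [Finite ι]
    (L : AddSubgroup (ι → ℤ)) : ∃ S : Set (MvPolynomial ι k),
      IsBinomialGenerating (latticeIdeal k L) S ∧ S.encard = mu (latticeIdeal k L) := by
  obtain ⟨S, -, hS⟩ := exists_finite_isBinomialGenerating k L
  have : Nonempty {S : Set (MvPolynomial ι k) // IsBinomialGenerating (latticeIdeal k L) S} :=
    ⟨⟨S, hS⟩⟩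
  obtain ⟨T, hT⟩ := ENat.exists_eq_iInf
    (fun S : {S : Set (MvPolynomial ι k) // IsBinomialGenerating (latticeIdeal k L) S} =>
      S.1.encard)
  exact ⟨T.1, T.2, hT⟩

/-! ### Nonnegative vectors and the pure part -/

theorem exists_mem_plus_pos {ι : Type*} [Finite ι] (L : AddSubgroup (ι → ℤ)) :
    ∃ w ∈ plus L, ∀ i ∈ sigma L, 0 < w i := by
  classical
  have := Fintype.ofFinite ι
  have h (i : ι) : ∃ u ∈ plus L, i ∈ sigma L → 0 < u i := by
    by_cases hi : i ∈ sigma L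
    · obtain ⟨u, hu, hui⟩ := Set.mem_iUnion₂.1 hi
      exact ⟨u, hu, fun _ => lt_of_le_of_ne (hu.2 i) (Ne.symm hui)⟩
    · exact ⟨0, ⟨L.zero_mem, fun _ => le_rfl⟩, fun h => absurd h hi⟩
  choose u hu hpos using h
  refine ⟨∑ i, u i, ⟨L.sum_mem fun i _ => (hu i).1, fun j => ?_⟩, fun j hj => ?_⟩
  · rw [Finset.sum_apply]
    exact Finset.sum_nonneg fun i _ => (hu i).2 j
  · rw [Finset.sum_apply]
    exact Finset.sum_pos' (fun i _ => (hu i).2 j) ⟨j, Finset.mem_univ j, hpos j hj⟩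

theorem eq_zero_of_mem_plus {ι : Type*} {L : AddSubgroup (ι → ℤ)} {u : ι → ℤ} (hu : u ∈ plus L)
    {i : ι} (hi : i ∉ sigma L) : u i = 0 := by
  by_contra h
  exact hi (Set.mem_iUnion₂.2 ⟨u, hu, h⟩)

theorem exists_add_smul_mem_plus {ι : Type*} [Finite ι] {L : AddSubgroup (ι → ℤ)}
    {u w : ι → ℤ} (hu : u ∈ L) (hu0 : ∀ i ∉ sigma L, 0 ≤ u i) (hw : w ∈ plus L)
    (hpos : ∀ i ∈ sigma L, 0 < w i) :
    ∃ N : ℕ, u + N • w ∈ plus L ∧ ∀ i ∈ sigma L, 0 < (u + N • w) i := by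
  have := Fintype.ofFinite ι
  -- This exceeds every `-u i`, and `w i ≥ 1` on `sigma L`.
  let N : ℕ := (∑ i, (u i).natAbs) + 1
  have hN (i : ι) : -u i < N := by
    have := Finset.single_le_sum (f := fun i => (u i).natAbs) (fun _ _ => Nat.zero_le _)
      (Finset.mem_univ i)
    simp only [N]
    push_cast
    zify at this
    have := neg_le_abs (u i)
    linarith
  have key : ∀ i ∈ sigma L, 0 < (u + N • w) i := fun i hi => by
    have h1 := hpos i hi
    have h2 := hN i
    simp only [Pi.add_apply, Pi.smul_apply, smul_eq_mul, ← natCast_zsmul]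
    nlinarith [Int.natCast_nonneg N]
  refine ⟨N, ⟨L.add_mem hu (L.nsmul_mem hw.1 N), fun i => ?_⟩, key⟩
  by_cases hi : i ∈ sigma L
  · exact (key i hi).le
  · have := hu0 i hi
    simpa [eq_zero_of_mem_plus hw hi] using this

theorem eq_zero_of_nonneg_outside {ι : Type*} [Finite ι] {L : AddSubgroup (ι → ℤ)}
    {u : ι → ℤ} (hu : u ∈ L) (hu0 : ∀ i ∉ sigma L, 0 ≤ u i) {i : ι} (hi : i ∉ sigma L) :
    u i = 0 := by
  obtain ⟨w, hw, hpos⟩ := exists_mem_plus_pos L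
  obtain ⟨N, hN, -⟩ := exists_add_smul_mem_plus hu hu0 hw hpos
  simpa [eq_zero_of_mem_plus hw hi] using eq_zero_of_mem_plus hN hi

theorem isPositivelyGraded_projOutside {ι : Type*} [Finite ι] (L : AddSubgroup (ι → ℤ)) :
    IsPositivelyGraded (projOutside L) := by
  refine Set.Subset.antisymm ?_ ?_
  · rintro _ ⟨⟨u, hu, rfl⟩, h⟩
    refine funext fun i => ?_
    exact eq_zero_of_nonneg_outside hu (fun i hi => h ⟨i, hi⟩) i.2
  · rintro _ rfl
    exact ⟨AddSubgroup.zero_mem _, fun _ => le_rfl⟩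

theorem mem_purePart {ι : Type*} [Finite ι] {L : AddSubgroup (ι → ℤ)} {u : ι → ℤ} :
    u ∈ purePart L ↔ u ∈ L ∧ ∀ i ∉ sigma L, u i = 0 := by
  constructor
  · intro hu
    refine ⟨(AddSubgroup.closure_le L).2 (fun _ h => h.1) hu, fun i hi => ?_⟩
    have : purePart L ≤ (Pi.evalAddMonoidHom (fun _ : ι => ℤ) i).ker :=
      (AddSubgroup.closure_le _).2 fun v hv => eq_zero_of_mem_plus hv hi
    exact this hu
  · rintro ⟨hu, h⟩
    obtain ⟨w, hw, hpos⟩ := exists_mem_plus_pos L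
    obtain ⟨N, hN, -⟩ := exists_add_smul_mem_plus hu (fun i hi => (h i hi).ge) hw hpos
    -- `u = (u + N • w) - N • w` is a difference of two vectors of `L⁺`.
    have := (purePart L).sub_mem (AddSubgroup.subset_closure hN)
      ((purePart L).nsmul_mem (AddSubgroup.subset_closure hw) N)
    simpa using this

/-! ### Nonnegative generators of the pure part -/

/-- Division with remainder: if `d x = m w`, then `x - (m / d) w` is `(m % d) / d` times `w`. A
nonzero remainder would give a vector positive on `sigma L` with smaller coordinate sum than `w`.
This makes the quotient by `w` torsion-free. -/
theorem mem_span_singleton_of_smul_mem {ι : Type*} [Fintype ι] {L : AddSubgroup (ι → ℤ)}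
    {w : purePart L} (hne : (sigma L).Nonempty) (hpos : ∀ i ∈ sigma L, 0 < w.1 i)
    (hmin : ∀ y ∈ plus L, (∀ i ∈ sigma L, 0 < y i) → ∑ i, w.1 i ≤ ∑ i, y i)
    {d : ℤ} (hd : d ≠ 0) {x : purePart L} (h : d • x ∈ Submodule.span ℤ {w}) :
    x ∈ Submodule.span ℤ {w} := by
  wlog hd0 : 0 < d generalizing d
  · refine this (neg_ne_zero.2 hd) ?_ (by omega)
    rw [neg_smul]
    exact Submodule.neg_mem _ h
  obtain ⟨m, hm⟩ := Submodule.mem_span_singleton.1 h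
  obtain ⟨j, hj⟩ := hne
  have hw := mem_purePart.1 w.2
  have hx := mem_purePart.1 x.2
  have hm' (i : ι) : m * w.1 i = d * x.1 i := by
    have := congrArg (fun z : purePart L => z.1 i) hm
    simpa using this
  let y : ι → ℤ := x.1 - (m / d) • w.1
  have hy (i : ι) : d * y i = (m % d) * w.1 i := by
    simp only [y, Pi.sub_apply, Pi.smul_apply, smul_eq_mul]
    rw [Int.emod_def, sub_mul, hm']
    ring
  have hs0 := Int.emod_nonneg m hd
  have hsd := Int.emod_lt_of_pos m hd0
  have hs : m % d = 0 := by
    by_contra hs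
    have hs1 : 0 < m % d := lt_of_le_of_ne hs0 (Ne.symm hs)
    have hypos : ∀ i ∈ sigma L, 0 < y i := fun i hi => by
      have h1 := mul_pos hs1 (hpos i hi)
      rw [← hy] at h1
      exact pos_of_mul_pos_right h1 hd0.le
    have hyL : y ∈ plus L := by
      refine ⟨L.sub_mem hx.1 (L.zsmul_mem hw.1 _), fun i => ?_⟩
      by_cases hi : i ∈ sigma L
      · exact (hypos i hi).le
      · simp [y, hx.2 i hi, hw.2 i hi]
    have h1 := hmin y hyL hypos
    have h2 : ∑ i, d * y i = ∑ i, (m % d) * w.1 i := Finset.sum_congr rfl fun i _ => hy i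
    rw [← Finset.mul_sum, ← Finset.mul_sum] at h2
    have h3 : 0 < ∑ i, w.1 i := by
      refine Finset.sum_pos' (fun i _ => ?_) ⟨j, Finset.mem_univ j, hpos j hj⟩
      by_cases hi : i ∈ sigma L
      · exact (hpos i hi).le
      · exact (hw.2 i hi).ge
    nlinarith
  refine Submodule.mem_span_singleton.2 ⟨m / d, Subtype.ext (funext fun i => ?_)⟩
  have h1 := hy i
  rw [hs, zero_mul] at h1
  have h2 : y i = 0 := (mul_eq_zero.1 h1).resolve_left hd
  simp only [y, Pi.sub_apply, sub_eq_zero] at h2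
  simpa using h2.symm

instance finite_purePart {ι : Type*} [Finite ι] (L : AddSubgroup (ι → ℤ)) :
    Module.Finite ℤ (purePart L) :=
  inferInstanceAs (Module.Finite ℤ (AddSubgroup.toIntSubmodule (purePart L)))

/-- The pure part of a lattice is generated by as many nonnegative vectors as its rank says. -/
theorem exists_generators_purePart {ι : Type*} [Finite ι] (L : AddSubgroup (ι → ℤ)) :
    ∃ B ⊆ plus L, AddSubgroup.closure B = purePart L ∧
      B.encard ≤ Module.finrank ℤ (purePart L) := by
  have := Fintype.ofFinite ι
  rcases (sigma L).eq_empty_or_nonempty with h | hne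
  · refine ⟨∅, Set.empty_subset _, ?_, by simp⟩
    rw [AddSubgroup.closure_empty, eq_comm, AddSubgroup.eq_bot_iff_forall]
    exact fun u hu => funext fun i => (mem_purePart.1 hu).2 i (by simp [h])
  obtain ⟨w, ⟨hwL, hpos⟩, hmin⟩ := WellFounded.has_min
    (measure fun y : ι → ℤ => (∑ i, y i).toNat).wf
    {w | w ∈ plus L ∧ ∀ i ∈ sigma L, 0 < w i} (exists_mem_plus_pos L)
  replace hmin : ∀ y ∈ plus L, (∀ i ∈ sigma L, 0 < y i) → ∑ i, w i ≤ ∑ i, y i := by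
    intro y hy hy'
    have h1 : ¬ (∑ i, y i).toNat < (∑ i, w i).toNat := hmin y ⟨hy, hy'⟩
    have h2 : 0 ≤ ∑ i, y i := Finset.sum_nonneg fun i _ => hy.2 i
    omega
  let w' : purePart L := ⟨w, AddSubgroup.subset_closure hwL⟩
  have hw' : w' ≠ 0 := fun h0 => by
    obtain ⟨j, hj⟩ := hne
    have := congrArg (fun z : purePart L => z.1 j) h0
    exact (hpos j hj).ne' this
  let Q := purePart L ⧸ Submodule.span ℤ {w'}
  have : Module.IsTorsionFree ℤ Q := by
    refine Module.isTorsionFree_iff_smul_eq_zero.2 ?_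
    intro r m hm
    obtain ⟨x, rfl⟩ := Submodule.mkQ_surjective _ m
    refine or_iff_not_imp_left.2 fun hr => ?_
    rw [← map_smul, Submodule.mkQ_apply, Submodule.Quotient.mk_eq_zero] at hm
    rw [Submodule.mkQ_apply, Submodule.Quotient.mk_eq_zero]
    exact mem_span_singleton_of_smul_mem hne hpos hmin hr hm
  -- `Q` is free of rank one less. Lifts of a basis can be made nonnegative by adding multiples of
  -- `w`, which is itself among the generators.
  let e := Module.finBasis ℤ Q
  choose v hv using fun j => Submodule.mkQ_surjective (Submodule.span ℤ {w'}) (e j)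
  choose N hN _ using fun j => exists_add_smul_mem_plus (mem_purePart.1 (v j).2).1
    (fun i hi => ((mem_purePart.1 (v j).2).2 i hi).ge) hwL hpos
  let B := insert w (Set.range fun j => (v j).1 + N j • w)
  have hB : B ⊆ plus L := Set.insert_subset hwL (Set.range_subset_iff.2 hN)
  refine ⟨B, hB, le_antisymm (AddSubgroup.closure_mono hB) fun x hx => ?_, ?_⟩
  · have hwB : w ∈ AddSubgroup.closure B := AddSubgroup.subset_closure (Set.mem_insert _ _)
    have hvB (j) : (v j).1 ∈ AddSubgroup.closure B := by
      have := AddSubgroup.sub_mem _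
        (AddSubgroup.subset_closure (Set.mem_insert_of_mem w (Set.mem_range_self j)))
        (AddSubgroup.nsmul_mem _ hwB (N j))
      rwa [add_sub_cancel_right] at this
    let c := e.repr (Submodule.Quotient.mk ⟨x, hx⟩)
    have hc : (⟨x, hx⟩ : purePart L) - ∑ j, c j • v j ∈ Submodule.span ℤ {w'} := by
      refine (Submodule.Quotient.mk_eq_zero _).1 ?_
      rw [← Submodule.mkQ_apply, map_sub, map_sum, sub_eq_zero]
      simp only [map_smul, hv]
      exact (e.sum_repr _).symm
    obtain ⟨m, hm⟩ := Submodule.mem_span_singleton.1 hc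
    have hxe : x = m • w + ∑ j, c j • (v j).1 := by
      have := congrArg (fun z : purePart L => z.1) (eq_sub_iff_add_eq.1 hm)
      simpa [w'] using this.symm
    rw [hxe]
    exact AddSubgroup.add_mem _ (AddSubgroup.zsmul_mem _ hwB m)
      (AddSubgroup.sum_mem _ fun j _ => AddSubgroup.zsmul_mem _ (hvB j) _)
  · have h1 := (Submodule.span ℤ {w'}).finrank_quotient_add_finrank
    have h2 : Module.finrank ℤ (Submodule.span ℤ {w'}) = 1 := by
      rw [← (LinearEquiv.toSpanNonzeroSingleton ℤ _ w' hw').finrank_eq, Module.finrank_self]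
    rw [← h1, h2]
    refine (Set.encard_insert_le _ _).trans ?_
    push_cast
    gcongr
    rw [← Set.image_univ]
    refine (Set.encard_image_le _ _).trans ?_
    simp [Set.encard_univ, Q]

/-! ### Setting the variables in `σ` to `1` -/

/-- The restriction of exponents to the coordinates outside `s`. -/
noncomputable def restrict {ι : Type*} (s : Set ι) : (ι →₀ ℕ) →+ ({i // i ∉ s} →₀ ℕ) :=
  Finsupp.subtypeDomainAddMonoidHom

@[simp]
theorem restrict_apply {ι : Type*} (s : Set ι) (u : ι →₀ ℕ) (i : {i // i ∉ s}) :
    restrict s u i = u i := rfl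

theorem restrict_eq_iff {ι : Type*} {s : Set ι} {u v : ι →₀ ℕ} :
    restrict s u = restrict s v ↔ ∀ i ∉ s, u i = v i :=
  ⟨fun h i hi => DFunLike.congr_fun h ⟨i, hi⟩, fun h => Finsupp.ext fun i => h i i.2⟩

theorem exists_restrict_eq {ι : Type*} [Finite ι] {s : Set ι} {a b : {i // i ∉ s} →₀ ℕ}
    {u : ι → ℤ} (h : ∀ i, u i.1 = a i - b i) :
    ∃ p q : ι →₀ ℕ, restrict s p = a ∧ restrict s q = b ∧ ∀ i, (p i : ℤ) - q i = u i := by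
  classical
  -- On `s`, take the positive and negative parts of `u`.
  refine ⟨Finsupp.equivFunOnFinite.symm fun i => if hi : i ∉ s then a ⟨i, hi⟩ else (u i).toNat,
    Finsupp.equivFunOnFinite.symm fun i => if hi : i ∉ s then b ⟨i, hi⟩ else (-u i).toNat,
    ?_, ?_, fun i => ?_⟩
  · ext i; simp [i.2]
  · ext i; simp [i.2]
  · by_cases hi : i ∈ s
    · simp [hi]
    · simp [hi, h ⟨i, hi⟩]

/-- The ring homomorphism that sets the variables in `s` equal to `1`. -/
noncomputable def dehomogenize (k : Type*) [Field k] {ι : Type*} (s : Set ι) :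
    MvPolynomial ι k →+* MvPolynomial {i // i ∉ s} k :=
  AddMonoidAlgebra.mapDomainRingHom k (restrict s)

theorem dehomogenize_binomial (k : Type*) [Field k] {ι : Type*} (s : Set ι) (u v : ι →₀ ℕ) :
    dehomogenize k s (binomial k u v) = binomial k (restrict s u) (restrict s v) := by
  have h (w : ι →₀ ℕ) : dehomogenize k s (monomial w 1) = monomial (restrict s w) 1 :=
    AddMonoidAlgebra.mapDomain_single
  simp only [binomial, map_sub, h]

theorem exists_lift_of_mem_projOutside {ι : Type*} [Finite ι] {L : AddSubgroup (ι → ℤ)}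
    {a b : {i // i ∉ sigma L} →₀ ℕ} (h : (fun i => (a i : ℤ) - (b i : ℤ)) ∈ projOutside L) :
    ∃ p q : ι →₀ ℕ, restrict (sigma L) p = a ∧ restrict (sigma L) q = b ∧
      (fun i => (p i : ℤ) - (q i : ℤ)) ∈ L := by
  obtain ⟨u, hu, hab⟩ := h
  obtain ⟨p, q, hp, hq, hpq⟩ := exists_restrict_eq (a := a) (b := b) (u := u)
    fun i => congrFun hab i
  exact ⟨p, q, hp, hq, by rwa [funext hpq]⟩

theorem map_dehomogenize_latticeIdeal (k : Type*) [Field k] {ι : Type*} [Finite ι]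
    (L : AddSubgroup (ι → ℤ)) :
    (latticeIdeal k L).map (dehomogenize k (sigma L)) = latticeIdeal k (projOutside L) := by
  refine le_antisymm ?_ (Ideal.span_le.2 ?_)
  · rw [latticeIdeal, Ideal.map_span, Ideal.span_le]
    rintro _ ⟨_, ⟨u, v, h, rfl⟩, rfl⟩
    rw [dehomogenize_binomial, SetLike.mem_coe, binomial_mem_latticeIdeal]
    exact ⟨_, h, rfl⟩
  · rintro _ ⟨a, b, h, rfl⟩
    obtain ⟨p, q, rfl, rfl, hpq⟩ := exists_lift_of_mem_projOutside h
    rw [← dehomogenize_binomial]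
    exact Ideal.mem_map_of_mem _ (binomial_mem_latticeIdeal.2 hpq)

/-! ### The lower bound -/

/-- The congruence that identifies exponents supported in `s` if their difference lies in `D`, and
identifies all exponents whose support is not contained in `s`. -/
def supportedCon {ι : Type*} (s : Set ι) (D : AddSubgroup (ι → ℤ)) : AddCon (ι →₀ ℕ) where
  r u v := (restrict s u = 0 ↔ restrict s v = 0) ∧ (restrict s u = 0 → latticeCon D u v)
  iseqv :=
    { refl := fun u => ⟨Iff.rfl, fun _ => (latticeCon D).refl u⟩
      symm := fun h => ⟨h.1.symm, fun h' => (latticeCon D).symm (h.2 (h.1.2 h'))⟩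
      trans := fun h h' => ⟨h.1.trans h'.1,
        fun h'' => (latticeCon D).trans (h.2 h'') (h'.2 (h.1.1 h''))⟩ }
  add' := fun h h' => by
    simp only [map_add, add_eq_zero]
    exact ⟨and_congr h.1 h'.1, fun h'' => (latticeCon D).add (h.2 h''.1) (h'.2 h''.2)⟩

theorem supportedCon_iff {ι : Type*} {s : Set ι} {D : AddSubgroup (ι → ℤ)} {u v : ι →₀ ℕ} :
    supportedCon s D u v ↔
      (restrict s u = 0 ↔ restrict s v = 0) ∧ (restrict s u = 0 → latticeCon D u v) :=
  Iff.rfl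

theorem restrict_eq_zero_iff_of_mem {ι : Type*} [Finite ι] {L : AddSubgroup (ι → ℤ)}
    {u v : ι →₀ ℕ} (h : (fun i => (u i : ℤ) - (v i : ℤ)) ∈ L) :
    restrict (sigma L) u = 0 ↔ restrict (sigma L) v = 0 := by
  have key : ∀ {u v : ι →₀ ℕ}, latticeCon L u v →
      restrict (sigma L) v = 0 → restrict (sigma L) u = 0 := by
    intro u v h hv
    rw [← map_zero (restrict (sigma L)), restrict_eq_iff] at hv ⊢
    intro i hi
    have h0 := eq_zero_of_nonneg_outside (latticeCon_iff.1 h)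
      (fun j hj => by simp [hv j hj]) hi
    simpa [hv i hi] using h0
  exact ⟨key ((latticeCon L).symm h), key h⟩

theorem finrank_le_encard_of_le_closure {ι : Type*} [Finite ι] {M : AddSubgroup (ι → ℤ)}
    {D : Set (ι → ℤ)} (h : M ≤ AddSubgroup.closure D) : (Module.finrank ℤ M : ℕ∞) ≤ D.encard := by
  by_cases hD : D.Finite
  swap
  · simp [Set.Infinite.encard_eq hD]
  have := hD.fintype
  have h1 : AddSubgroup.toIntSubmodule M ≤ Submodule.span ℤ D := by
    intro x hx
    have h2 := h hx
    rwa [← Submodule.span_int_eq_addSubgroupClosure] at h2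
  have h2 : Module.finrank ℤ M ≤ D.toFinset.card :=
    (Submodule.finrank_mono h1).trans (finrank_span_le_card D)
  rw [Set.encard_eq_coe_toFinset_card]
  exact_mod_cast h2

theorem mu_projOutside_add_finrank_le (k : Type*) [Field k] {ι : Type*} [Finite ι]
    (L : AddSubgroup (ι → ℤ)) :
    mu (latticeIdeal k (projOutside L)) + (Module.finrank ℤ (purePart L) : ℕ∞) ≤
      mu (latticeIdeal k L) := by
  obtain ⟨S, ⟨hS, hSL⟩, hSmu⟩ := exists_encard_eq_mu k L
  have hex (f : MvPolynomial ι k) : ∃ u v : ι →₀ ℕ, f ∈ S → f = binomial k u v := by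
    by_cases hf : f ∈ S
    · obtain ⟨u, v, h⟩ := hS f hf
      exact ⟨u, v, fun _ => h⟩
    · exact ⟨0, 0, fun h => absurd h hf⟩
  choose U V hUV using hex
  have hL : ∀ f ∈ S, latticeCon L (U f) (V f) := fun f hf => by
    rw [latticeCon_iff, ← binomial_mem_latticeIdeal (k := k), ← hUV f hf, ← hSL]
    exact Ideal.subset_span hf
  let S₀ : Set (MvPolynomial ι k) := {f ∈ S | restrict (sigma L) (U f) = 0}
  let d : MvPolynomial ι k → ι → ℤ := fun f i => (U f i : ℤ) - (V f i : ℤ)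
  have hrank : (Module.finrank ℤ (purePart L) : ℕ∞) ≤ S₀.encard := by
    refine (finrank_le_encard_of_le_closure ?_).trans (Set.encard_image_le d S₀)
    refine (AddSubgroup.closure_le _).2 fun b hb => ?_
    -- With `s = ∅` this merely rewrites `b` as an exponent `p`, with `q = 0`.
    obtain ⟨p, q, -, hq, hpq⟩ := exists_restrict_eq (s := ∅)
      (a := Finsupp.equivFunOnFinite.symm fun i => (b i.1).toNat) (b := 0) (u := b)
      (fun i => by simp [hb.2 i.1])
    have hq0 : q = 0 := by
      ext i
      exact DFunLike.congr_fun hq ⟨i, Set.notMem_empty i⟩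
    have hpb : (fun i => (p i : ℤ) - (q i : ℤ)) = b := funext hpq
    have hmem : binomial k p q ∈ Ideal.span S := by
      rw [hSL, binomial_mem_latticeIdeal, hpb]
      exact hb.1
    -- Generators outside `S₀` hold trivially in this congruence, so only `S₀` can relate `p` to
    -- `0`.
    have hcon := addCon_of_binomial_mem_span
      (supportedCon (sigma L) (AddSubgroup.closure (d '' S₀))) (fun f hf =>
        ⟨U f, V f, supportedCon_iff.2 ⟨restrict_eq_zero_iff_of_mem (hL f hf), fun h0 =>
          AddSubgroup.subset_closure ⟨f, ⟨hf, h0⟩, rfl⟩⟩, hUV f hf⟩) hmem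
    have h0 : restrict (sigma L) p = 0 := hcon.1.2 (by rw [hq0, map_zero])
    have := hcon.2 h0
    rw [latticeCon_iff, hpb] at this
    exact this
  have hmu : mu (latticeIdeal k (projOutside L)) ≤ (S \ S₀).encard := by
    refine (mu_le (S := dehomogenize k (sigma L) '' (S \ S₀)) ⟨?_, ?_⟩).trans
      (Set.encard_image_le _ _)
    · rintro _ ⟨f, hf, rfl⟩
      exact ⟨_, _, by rw [hUV f hf.1, dehomogenize_binomial]⟩
    · rw [← map_dehomogenize_latticeIdeal, ← hSL, Ideal.map_span]
      refine le_antisymm (Ideal.span_mono (Set.image_mono Set.sdiff_subset)) (Ideal.span_le.2 ?_)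
      rintro _ ⟨f, hf, rfl⟩
      by_cases h0 : f ∈ S₀
      · have h1 := (restrict_eq_zero_iff_of_mem (hL f hf)).1 h0.2
        rw [hUV f hf, dehomogenize_binomial, h0.2, h1, binomial, sub_self]
        exact Ideal.zero_mem _
      · exact Ideal.subset_span ⟨f, ⟨hf, h0⟩, rfl⟩
  rw [← hSmu, ← Set.encard_sdiff_add_encard_of_subset (Set.sep_subset S _ : S₀ ⊆ S)]
  exact add_le_add hmu hrank

/-! ### The upper bound -/

/-- The vector of naturals with the same positive coordinates as an integer vector. -/
noncomputable def toNatFinsupp {ι : Type*} [Finite ι] (b : ι → ℤ) : ι →₀ ℕ :=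
  Finsupp.equivFunOnFinite.symm fun i => (b i).toNat

theorem toNatFinsupp_apply {ι : Type*} [Finite ι] {L : AddSubgroup (ι → ℤ)} {b : ι → ℤ}
    (hb : b ∈ plus L) (i : ι) : (toNatFinsupp b i : ℤ) = b i := by
  simp [toNatFinsupp, hb.2 i]

/-- The image of a congruence under the restriction of exponents to the coordinates outside `s`. -/
def restrictCon {ι : Type*} [Finite ι] (s : Set ι) (c : AddCon (ι →₀ ℕ)) :
    AddCon ({i // i ∉ s} →₀ ℕ) where
  r a b := ∃ p q, restrict s p = a ∧ restrict s q = b ∧ c p q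
  iseqv :=
    { refl := fun a => by
        obtain ⟨p, -, hp, -⟩ := exists_restrict_eq (a := a) (b := a) (u := 0) (by simp)
        exact ⟨p, p, hp, hp, c.refl p⟩
      symm := fun ⟨p, q, hp, hq, h⟩ => ⟨q, p, hq, hp, c.symm h⟩
      trans := by
        rintro a b d ⟨p, q, hp, hq, h⟩ ⟨p', q', hp', hq', h'⟩
        have hqp := restrict_eq_iff.1 (hq.trans hp'.symm)
        -- `q` and `p'` agree off `s`; the truncated differences raise both to their maximum without
        -- changing the restrictions.
        have h1 : restrict s (p' - q) = 0 := by
          rw [← map_zero (restrict s), restrict_eq_iff]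
          intro i hi
          simp [hqp i hi]
        have h2 : restrict s (q - p') = 0 := by
          rw [← map_zero (restrict s), restrict_eq_iff]
          intro i hi
          simp [hqp i hi]
        refine ⟨p + (p' - q), q' + (q - p'), by simp [hp, h1], by simp [hq', h2], ?_⟩
        have h3 : q + (p' - q) = p' + (q - p') := by
          ext i
          simp only [Finsupp.add_apply, Finsupp.tsub_apply]
          omega
        exact c.trans (c.add h (c.refl _)) (h3 ▸ c.add h' (c.refl _)) }
  add' := by
    rintro _ _ _ _ ⟨p, q, rfl, rfl, h⟩ ⟨p', q', rfl, rfl, h'⟩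
    exact ⟨p + p', q + q', map_add _ _ _, map_add _ _ _, c.add h h'⟩

section

variable {ι : Type*} [Finite ι] {L : AddSubgroup (ι → ℤ)} {B : Set (ι → ℤ)}
  {c : AddCon (ι →₀ ℕ)}

theorem exists_pos_of_closure_eq_purePart (hB : B ⊆ plus L)
    (hBL : AddSubgroup.closure B = purePart L) {i : ι} (hi : i ∈ sigma L) : ∃ b ∈ B, 0 < b i := by
  obtain ⟨w, hw, hpos⟩ := exists_mem_plus_pos L
  by_contra! h
  have h1 : AddSubgroup.closure B ≤ (Pi.evalAddMonoidHom (fun _ : ι => ℤ) i).ker :=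
    (AddSubgroup.closure_le _).2 fun b hb => le_antisymm (h b hb) ((hB hb).2 i)
  have h2 : w i = 0 := h1 (hBL ▸ AddSubgroup.subset_closure hw)
  exact (hpos i hi).ne' h2

/-- Exponents supported in `sigma L` are invertible modulo a congruence that kills generators of
the pure part. -/
theorem exists_add_rel_zero (hB : B ⊆ plus L) (hBL : AddSubgroup.closure B = purePart L)
    (hc : ∀ b ∈ B, c (toNatFinsupp b) 0) (p : ι →₀ ℕ) (hp : restrict (sigma L) p = 0) :
    ∃ p', c (p + p') 0 := by
  classical
  induction p using Finsupp.induction_linear with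
  | zero => exact ⟨0, c.refl _⟩
  | add f g hf hg =>
    rw [map_add, add_eq_zero] at hp
    obtain ⟨f', hf'⟩ := hf hp.1
    obtain ⟨g', hg'⟩ := hg hp.2
    refine ⟨f' + g', ?_⟩
    have := c.add hf' hg'
    rwa [add_zero, add_add_add_comm] at this
  | single i n =>
    by_cases hi : i ∈ sigma L
    · obtain ⟨b, hb, hbi⟩ := exists_pos_of_closure_eq_purePart hB hBL hi
      -- `b - e_i` is an inverse of `e_i`, because `b` is congruent to `0`.
      refine ⟨n • (toNatFinsupp b - Finsupp.single i 1), ?_⟩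
      have h1 : Finsupp.single i n + n • (toNatFinsupp b - Finsupp.single i 1) =
          n • toNatFinsupp b := by
        have h2 : Finsupp.single i 1 ≤ toNatFinsupp b := by
          rw [Finsupp.single_le_iff]
          have := toNatFinsupp_apply (hB hb) i
          omega
        rw [← Finsupp.smul_single_one i n, ← smul_add, add_tsub_cancel_of_le h2]
      rw [h1]
      simpa using c.nsmul n (hc b hb)
    · rw [← map_zero (restrict (sigma L)), restrict_eq_iff] at hp
      have := hp i hi
      rw [Finsupp.single_eq_same] at this
      change n = 0 at this
      subst this
      exact ⟨0, by simpa using c.refl _⟩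

theorem rel_of_add_rel_add (hB : B ⊆ plus L) (hBL : AddSubgroup.closure B = purePart L)
    (hc : ∀ b ∈ B, c (toNatFinsupp b) 0) {p u v : ι →₀ ℕ} (hp : restrict (sigma L) p = 0)
    (h : c (u + p) (v + p)) : c u v := by
  obtain ⟨p', hp'⟩ := exists_add_rel_zero hB hBL hc p hp
  have h1 (w : ι →₀ ℕ) : c (w + p + p') w := by
    have := c.add (c.refl w) hp'
    rwa [add_zero, ← add_assoc] at this
  exact c.trans (c.symm (h1 u)) (c.trans (c.add h (c.refl p')) (h1 v))

/-- Writing `p - q = s - t` with `s`, `t` congruent and supported in `sigma L` gives `p + t = q +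
s`, congruent to `q + t`; then `t` cancels. -/
theorem rel_of_sub_mem_purePart (hB : B ⊆ plus L) (hBL : AddSubgroup.closure B = purePart L)
    (hc : ∀ b ∈ B, c (toNatFinsupp b) 0) {p q : ι →₀ ℕ} (h : latticeCon (purePart L) p q) :
    c p q := by
  have key : ∀ z ∈ AddSubgroup.closure B, ∃ s t : ι →₀ ℕ, restrict (sigma L) t = 0 ∧
      restrict (sigma L) s = 0 ∧ (∀ i, (s i : ℤ) - t i = z i) ∧ c s t := by
    intro z hz
    induction hz using AddSubgroup.closure_induction with
    | mem b hb =>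
      refine ⟨toNatFinsupp b, 0, map_zero _, ?_, fun i => ?_, hc b hb⟩
      · rw [← map_zero (restrict (sigma L)), restrict_eq_iff]
        intro i hi
        have := toNatFinsupp_apply (hB hb) i
        rw [eq_zero_of_mem_plus (hB hb) hi] at this
        exact_mod_cast this
      · simp [toNatFinsupp_apply (hB hb) i]
    | zero => exact ⟨0, 0, map_zero _, map_zero _, by simp, c.refl _⟩
    | add x y _ _ hx hy =>
      obtain ⟨s, t, h1, h2, h3, h4⟩ := hx
      obtain ⟨s', t', h1', h2', h3', h4'⟩ := hy
      refine ⟨s + s', t + t', by simp [h1, h1'], by simp [h2, h2'], fun i => ?_, c.add h4 h4'⟩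
      simp only [Finsupp.add_apply, Pi.add_apply, ← h3, ← h3']
      push_cast
      ring
    | neg x _ hx =>
      obtain ⟨s, t, h1, h2, h3, h4⟩ := hx
      exact ⟨t, s, h2, h1, fun i => by simp [← h3], c.symm h4⟩
  obtain ⟨s, t, ht, -, hst, hcst⟩ := key _ (hBL ▸ h)
  have h1 : p + t = q + s := by
    ext i
    have := hst i
    simp only [Finsupp.add_apply]
    omega
  refine rel_of_add_rel_add hB hBL hc ht ?_
  rw [h1]
  exact c.add (c.refl q) hcst

/-- A congruence below that of the lattice is equal to it if it contains the generators of the pure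
part and its restriction to the coordinates outside `sigma L` is the congruence of the projected
lattice. -/
theorem rel_of_restrictCon (hB : B ⊆ plus L) (hBL : AddSubgroup.closure B = purePart L)
    (hc : ∀ b ∈ B, c (toNatFinsupp b) 0) (hle : ∀ p q, c p q → latticeCon L p q)
    {u v : ι →₀ ℕ} (h : latticeCon L u v)
    (hr : restrictCon (sigma L) c (restrict (sigma L) u) (restrict (sigma L) v)) : c u v := by
  obtain ⟨p, q, hp, hq, hpq⟩ := hr
  rw [restrict_eq_iff] at hp hq
  -- Adding this to `u` allows the passage from `u` through `p` and `q` to `v`, up to an error in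
  -- the pure part; it is cancelled at the end.
  have hs : restrict (sigma L) ((p - u) + (v - q)) = 0 := by
    rw [← map_zero (restrict (sigma L)), restrict_eq_iff]
    intro i hi
    simp [hp i hi, hq i hi]
  have hu : u + ((p - u) + (v - q)) = p + ((u - p) + (v - q)) := by
    ext i
    simp only [Finsupp.add_apply, Finsupp.tsub_apply]
    omega
  have hv : q + ((u - p) + (v - q)) = v + ((q - v) + (u - p)) := by
    ext i
    simp only [Finsupp.add_apply, Finsupp.tsub_apply]
    omega
  have hpure : latticeCon (purePart L) ((q - v) + (u - p)) ((p - u) + (v - q)) := by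
    rw [latticeCon_iff, mem_purePart]
    constructor
    · convert L.sub_mem h (hle p q hpq) using 1
      ext i
      simp only [Finsupp.add_apply, Finsupp.tsub_apply, Pi.sub_apply]
      omega
    · intro i hi
      simp [hp i hi, hq i hi]
  refine rel_of_add_rel_add hB hBL hc hs ?_
  rw [hu]
  refine c.trans (c.add hpq (c.refl _)) ?_
  rw [hv]
  exact c.add (c.refl v) (rel_of_sub_mem_purePart hB hBL hc hpure)

end

theorem mu_le_mu_projOutside_add_finrank (k : Type*) [Field k] {ι : Type*} [Finite ι]
    (L : AddSubgroup (ι → ℤ)) :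
    mu (latticeIdeal k L) ≤
      mu (latticeIdeal k (projOutside L)) + (Module.finrank ℤ (purePart L) : ℕ∞) := by
  obtain ⟨T, ⟨hT, hTL⟩, hTmu⟩ := exists_encard_eq_mu k (projOutside L)
  obtain ⟨B, hB, hBL, hBcard⟩ := exists_generators_purePart L
  have hex (f : MvPolynomial {i // i ∉ sigma L} k) : ∃ p q : ι →₀ ℕ, f ∈ T →
      latticeCon L p q ∧ f = binomial k (restrict (sigma L) p) (restrict (sigma L) q) := by
    by_cases hf : f ∈ T
    · obtain ⟨a, b, rfl⟩ := hT f hf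
      have : binomial k a b ∈ latticeIdeal k (projOutside L) := hTL ▸ Ideal.subset_span hf
      obtain ⟨p, q, rfl, rfl, hpq⟩ :=
        exists_lift_of_mem_projOutside (binomial_mem_latticeIdeal.1 this)
      exact ⟨p, q, fun _ => ⟨hpq, rfl⟩⟩
    · exact ⟨0, 0, fun h => absurd h hf⟩
  choose P Q hPQ using hex
  let S₁ : Set (MvPolynomial ι k) := (fun f => binomial k (P f) (Q f)) '' T
  let S₂ : Set (MvPolynomial ι k) := (fun b => binomial k (toNatFinsupp b) 0) '' B
  have hgen : IsBinomialGenerating (latticeIdeal k L) (S₁ ∪ S₂) := by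
    refine ⟨?_, ?_⟩
    · rintro _ (⟨f, -, rfl⟩ | ⟨b, -, rfl⟩)
      exacts [⟨_, _, rfl⟩, ⟨_, _, rfl⟩]
    have hle : Ideal.span (S₁ ∪ S₂) ≤ latticeIdeal k L := by
      rw [Ideal.span_le]
      rintro _ (⟨f, hf, rfl⟩ | ⟨b, hb, rfl⟩)
      · exact binomial_mem_latticeIdeal.2 (hPQ f hf).1
      · refine binomial_mem_latticeIdeal.2 ?_
        convert (hB hb).1 using 1
        ext i
        simp [toNatFinsupp_apply (hB hb) i]
    refine le_antisymm hle (Ideal.span_le.2 ?_)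
    rintro _ ⟨u, v, huv, rfl⟩
    refine rel_of_restrictCon (c := idealCon (Ideal.span (S₁ ∪ S₂))) hB hBL
      (fun b hb => Ideal.subset_span (Or.inr ⟨b, hb, rfl⟩))
      (fun p q hpq => binomial_mem_latticeIdeal.1 (hle hpq)) huv ?_
    refine addCon_of_binomial_mem_span (k := k) (S := T) _ (fun f hf => ?_) ?_
    · exact ⟨_, _, ⟨P f, Q f, rfl, rfl, Ideal.subset_span (Or.inl ⟨f, hf, rfl⟩)⟩, (hPQ f hf).2⟩
    · rw [hTL, binomial_mem_latticeIdeal]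
      exact ⟨_, huv, rfl⟩
  calc mu (latticeIdeal k L) ≤ (S₁ ∪ S₂).encard := mu_le hgen
    _ ≤ S₁.encard + S₂.encard := Set.encard_union_le _ _
    _ ≤ T.encard + B.encard := add_le_add (Set.encard_image_le _ _) (Set.encard_image_le _ _)
    _ ≤ _ := by rw [hTmu]; gcongr

end BinomialLattice

theorem theorem5p4 (k : Type*) [Field k] (n : ℕ) (L : AddSubgroup (Fin n → ℤ)) :
    BinomialLattice.IsPositivelyGraded (BinomialLattice.projOutside L) ∧
    BinomialLattice.mu (BinomialLattice.latticeIdeal k L) ≠ ⊤ ∧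
    BinomialLattice.mu (BinomialLattice.latticeIdeal k (BinomialLattice.projOutside L)) ≠ ⊤ ∧
    BinomialLattice.mu (BinomialLattice.latticeIdeal k L) =
      BinomialLattice.mu (BinomialLattice.latticeIdeal k (BinomialLattice.projOutside L)) +
        (Module.finrank ℤ (BinomialLattice.purePart L) : ℕ∞) :=
  ⟨BinomialLattice.isPositivelyGraded_projOutside L,
    BinomialLattice.mu_latticeIdeal_ne_top k L, BinomialLattice.mu_latticeIdeal_ne_top k _,
    le_antisymm (BinomialLattice.mu_le_mu_projOutside_add_finrank k L)
      (BinomialLattice.mu_projOutside_add_finrank_le k L)⟩
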